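/- Let $n\ge 1$ and let $\ell_\infty$ be the complex Banach space of bounded sequences $(x_i)_{i\in\mathbb N}$ of complex numbers with the supremum norm. Let $P:\ell_\infty\to\mathbb C$ be a continuous $n$-homogeneous polynomial, that is, there is a symmetric $n$-linear form $A:\ell_\infty\times\cdots\times\ell_\infty\to\mathbb C$ with $P(x)=A(x,\ldots,x)$ for every $x\in\ell_\infty$, and there is a constant $k$ with $|P(x)|\le k\|x\|^n$ for every $x\in\ell_\infty$. Then there is a linear subspace $H\subset \ell_\infty$ such that $P(x)=0$ for every $x\in H$ and $H$ is isomorphic to $\ell_\infty$ (there is a linear homeomorphism of $\ell_\infty$ onto $H$). In particular, $H$ is not separable. -/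

import Mathlib

open scoped ENNReal

/-- `P : X → ℂ` is a continuous `n`-homogeneous polynomial on the complex normed space `X`: it is
the diagonal of a symmetric `n`-linear form, and `|P x| ≤ k ‖x‖ ^ n` for some constant `k`. -/
def IsContHomogeneousPolynomial {X : Type*} [NormedAddCommGroup X] [NormedSpace ℂ X]
    (n : ℕ) (P : X → ℂ) : Prop :=
  (∃ A : MultilinearMap ℂ (fun _ : Fin n => X) ℂ,
    (∀ (σ : Equiv.Perm (Fin n)) (v : Fin n → X), A (fun i => v (σ i)) = A v) ∧
    ∀ x : X, P x = A (fun _ => x)) ∧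
  ∃ k : ℝ, ∀ x : X, ‖P x‖ ≤ k * ‖x‖ ^ n

/-- The complex Banach space `l_∞` of bounded sequences with the supremum norm. -/
abbrev LInfty : Type := lp (fun _ : ℕ => ℂ) ∞

/-! Let `A` be the symmetric form of `P`; by polarization it is bounded on the unit ball. The
subspace comes from two reductions. Blocks: there are normalized, disjoint, finitely supported `u k`
such that `A` vanishes on every tuple of them. Given finitely many blocks, a further one only has to
solve finitely many polynomial equations without constant term; with more unknowns than equations,
Krull's height theorem and the Nullstellensatz give a nonzero solution. The isometry `T` sending
coordinate vectors to blocks turns `A` into a bounded form that vanishes on coordinate vectors.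
Almost disjoint sets: such a form vanishes on all sequences supported in some infinite `M`. The
number of slots not holding coordinate vectors is raised one at a time. At each stage finitely
supported perturbations do not matter, so vectors on almost disjoint sets behave as if disjointly
supported; with suitable phases the absolute values of the form add up and stay bounded. Hence only
countably many members of an uncountable almost disjoint family are bad. The subspace is the image
under `T` of an isometric copy of `LInfty` supported in `M`. -/

/-! ### Common zeros of polynomials. -/

open MvPolynomial in
/-- Fewer polynomials than variables, all without constant term, have a common nonzero zero. -/
theorem MvPolynomial.exists_ne_zero_forall_eval_eq_zero {ι : Type*} [Finite ι] {N : ℕ}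
    (hN : Nat.card ι < N) (p : ι → MvPolynomial (Fin N) ℂ) (hp : ∀ i, eval 0 (p i) = 0) :
    ∃ a : Fin N → ℂ, a ≠ 0 ∧ ∀ i, eval a (p i) = 0 := by
  classical
  have hdim : ringKrullDim (MvPolynomial (Fin N) ℂ) = N := by
    rw [MvPolynomial.ringKrullDim_of_isNoetherianRing, ringKrullDim_eq_zero_of_field]
    simp
  have hlt : ¬ ringKrullDim (MvPolynomial (Fin N) ℂ) ≤ (Nat.card ι : WithBot ℕ∞) := by
    rw [hdim, not_le]; exact_mod_cast hN
  rw [ringKrullDim_le_iff_isMaximal_height_le] at hlt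
  push Not at hlt
  obtain ⟨m, hm, hlt⟩ := hlt
  obtain ⟨x, rfl⟩ := isMaximal_iff_eq_vanishingIdeal_singleton.1 hm
  -- The maximal ideal of large height belongs to some point `x`, not necessarily the origin, so the
  -- polynomials are translated to vanish at `x`.
  let q : ι → MvPolynomial (Fin N) ℂ := fun i => bind₁ (fun j => X j - C (x j)) (p i)
  have hq : ∀ (y : Fin N → ℂ) i, eval y (q i) = eval (y - x) (p i) := by
    intro y i
    simp only [q, eval, eval₂Hom_bind₁]
    congr 2
    ext j
    simp
  by_contra! H
  have hz : zeroLocus ℂ (Ideal.span (Set.range q)) = {x} := by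
    ext y
    rw [zeroLocus_span]
    simp only [Set.mem_ofPred_eq, Set.forall_mem_range, Set.mem_singleton_iff]
    constructor
    · intro h
      by_contra hne
      obtain ⟨i, hi⟩ := H (y - x) (sub_ne_zero.2 hne)
      exact hi (by rw [← hq]; exact h i)
    · rintro rfl i
      have := hq y i
      rw [sub_self, hp] at this
      exact this
  have hrad := vanishingIdeal_zeroLocus_eq_radical (K := ℂ) (k := ℂ) (Ideal.span (Set.range q))
  rw [hz] at hrad
  have hprime := hm.isPrime
  have hmin : vanishingIdeal ℂ {x} ∈ (Ideal.span (Set.range q)).minimalPrimes := by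
    rw [← Ideal.radical_minimalPrimes, ← hrad, Ideal.minimalPrimes_eq_subsingleton_self]
    rfl
  -- Krull's height theorem: an isolated common zero contradicts the height of the maximal ideal.
  have hle := Ideal.height_le_card_of_mem_minimalPrimes_span (Set.finite_range q) hmin
  have hc : (Set.range q).ncard ≤ Nat.card ι := by
    rw [← Nat.card_coe_set_eq]
    exact Finite.card_range_le q
  have h2 : ((vanishingIdeal ℂ {x}).height : WithBot ℕ∞) ≤ (Nat.card ι : ℕ∞) := by
    exact_mod_cast hle.trans (by exact_mod_cast hc)
  exact absurd h2 (not_le.2 hlt)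

/-! ### Multilinear forms: polarization and choice of phases. -/

/-- A multilinear map applied to linear combinations with polynomial coefficients is a
polynomial. -/
theorem MultilinearMap.exists_mvPolynomial {ι κ σ V : Type*} [Fintype ι] [Fintype κ]
    [AddCommGroup V] [Module ℂ V] (A : MultilinearMap ℂ (fun _ : ι => V) ℂ)
    (q : ι → κ → MvPolynomial σ ℂ) (b : ι → κ → V) :
    ∃ p : MvPolynomial σ ℂ, ∀ a : σ → ℂ,
      MvPolynomial.eval a p = A fun j => ∑ i, MvPolynomial.eval a (q j i) • b j i := by
  classical
  refine ⟨∑ s : ι → κ, (∏ j, q j (s j)) * MvPolynomial.C (A fun j => b j (s j)), fun a => ?_⟩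
  rw [A.map_sum]
  simp [map_prod, A.map_smul_univ]

/-- The polarization formula, with signs. -/
theorem MultilinearMap.polarization {ι V : Type*} [Fintype ι] [DecidableEq ι]
    [AddCommGroup V] [Module ℂ V] (A : MultilinearMap ℂ (fun _ : ι => V) ℂ)
    (hA : ∀ (σ : Equiv.Perm ι) (v : ι → V), A (fun i => v (σ i)) = A v) (v : ι → V) :
    ∑ ε : ι → ℤˣ, (∏ i, ((ε i : ℤ) : ℂ)) * A (fun _ => ∑ i, ((ε i : ℤ) : ℂ) • v i)
      = (2 ^ Fintype.card ι * (Fintype.card ι).factorial : ℂ) * A v := by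
  have key : ∀ r : ι → ι, ∑ ε : ι → ℤˣ, (∏ i, ((ε i : ℤ) : ℂ)) * ∏ j, ((ε (r j) : ℤ) : ℂ)
      = if Function.Bijective r then 2 ^ Fintype.card ι else 0 := by
    intro r
    split_ifs with hr
    · have : ∀ ε : ι → ℤˣ, (∏ i, ((ε i : ℤ) : ℂ)) * ∏ j, ((ε (r j) : ℤ) : ℂ) = 1 := by
        intro ε
        rw [hr.prod_comp (fun j => ((ε j : ℤ) : ℂ)), ← Finset.prod_mul_distrib]
        refine Finset.prod_eq_one fun i _ => ?_
        rcases Int.units_eq_one_or (ε i) with h | h <;> simp [h]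
      simp [this]
    · have hns : ¬ Function.Surjective r := fun h => hr (Finite.surjective_iff_bijective.1 h)
      obtain ⟨i₀, hi₀⟩ := not_forall.1 hns
      have hi₀' : ∀ j, r j ≠ i₀ := fun j h => hi₀ ⟨j, h⟩
      -- Flipping the sign at an index missed by `r` negates every term, so the sum is its own
      -- negative.
      have := Equiv.sum_comp (Equiv.mulRight (Pi.mulSingle i₀ (-1) : ι → ℤˣ))
        (fun ε : ι → ℤˣ => (∏ i, ((ε i : ℤ) : ℂ)) * ∏ j, ((ε (r j) : ℤ) : ℂ))
      have h1 : ∏ i, (((Pi.mulSingle i₀ (-1) : ι → ℤˣ) i : ℤ) : ℂ) = -1 := by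
        rw [Finset.prod_eq_single i₀]
        · simp
        · intro b _ hb
          simp [Pi.mulSingle_eq_of_ne hb]
        · simp
      simp only [Equiv.coe_mulRight, Pi.mul_apply, Units.val_mul, Int.cast_mul,
        Finset.prod_mul_distrib, h1, Pi.mulSingle_eq_of_ne (hi₀' _), mul_one, mul_neg, neg_mul, Finset.sum_neg_distrib] at this
      exact self_eq_neg.1 this.symm
  simp_rw [A.map_sum, A.map_smul_univ, Finset.mul_sum, smul_eq_mul, ← mul_assoc]
  rw [Finset.sum_comm]
  simp_rw [← Finset.sum_mul, key, ite_mul, zero_mul]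
  rw [← Finset.sum_filter]
  have : ∀ r ∈ Finset.univ.filter (fun r : ι → ι => Function.Bijective r),
      (2 : ℂ) ^ Fintype.card ι * A (fun i => v (r i)) = 2 ^ Fintype.card ι * A v := by
    intro r hr
    have hr := (Finset.mem_filter.1 hr).2
    rw [← hA (Equiv.ofBijective r hr) v]
    rfl
  rw [Finset.sum_congr rfl this, Finset.sum_const, nsmul_eq_mul]
  have hcard : (Finset.univ.filter (fun r : ι → ι => Function.Bijective r)).card
      = (Fintype.card ι).factorial := by
    rw [← Fintype.card_perm, ← Fintype.card_subtype]
    exact Fintype.card_congr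
      { toFun := fun r => Equiv.ofBijective r.1 r.2
        invFun := fun σ => ⟨σ, σ.bijective⟩
        left_inv := fun r => rfl
        right_inv := fun σ => by ext; rfl }
  rw [hcard]; ring

/-- Polarization expresses `A v` through diagonal values at signed sums of norm at most `n`; the
factor `2 ^ n * n!` is at least one and can be dropped. -/
theorem MultilinearMap.exists_bound_of_diagonal {ι V : Type*} [Fintype ι]
    [NormedAddCommGroup V] [NormedSpace ℂ V] (A : MultilinearMap ℂ (fun _ : ι => V) ℂ)
    (hA : ∀ (σ : Equiv.Perm ι) (v : ι → V), A (fun i => v (σ i)) = A v) (k : ℝ)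
    (hk : ∀ x : V, ‖A fun _ => x‖ ≤ k * ‖x‖ ^ Fintype.card ι) :
    ∃ K : ℝ, ∀ v : ι → V, (∀ i, ‖v i‖ ≤ 1) → ‖A v‖ ≤ K := by
  classical
  set n := Fintype.card ι
  refine ⟨∑ _ε : ι → ℤˣ, |k| * (n : ℝ) ^ n, fun v hv => ?_⟩
  have h1 : ∀ ε : ι → ℤˣ, ∀ i, ‖((ε i : ℤ) : ℂ)‖ = 1 := by
    intro ε i
    rcases Int.units_eq_one_or (ε i) with h | h <;> simp [h]
  have h2 : ‖(2 ^ n * n.factorial : ℂ) * A v‖ ≤ ∑ _ε : ι → ℤˣ, |k| * (n : ℝ) ^ n := by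
    rw [← A.polarization hA v]
    refine norm_sum_le_of_le _ fun ε _ => ?_
    rw [norm_mul, norm_prod]
    simp only [h1, Finset.prod_const_one, one_mul]
    have h3 : ‖∑ i, ((ε i : ℤ) : ℂ) • v i‖ ≤ n := by
      refine (norm_sum_le_of_le Finset.univ (n := fun _ => (1 : ℝ)) fun i _ => ?_).trans ?_
      · rw [norm_smul, h1, one_mul]; exact hv i
      · simp [n]
    calc _ ≤ k * ‖∑ i, ((ε i : ℤ) : ℂ) • v i‖ ^ n := hk _
      _ ≤ |k| * ‖∑ i, ((ε i : ℤ) : ℂ) • v i‖ ^ n := by gcongr; exact le_abs_self k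
      _ ≤ _ := by gcongr
  refine le_trans ?_ h2
  rw [norm_mul]
  refine le_mul_of_one_le_left (norm_nonneg _) ?_
  have : (1 : ℝ) ≤ ((2 ^ n * n.factorial : ℕ) : ℝ) := by
    exact_mod_cast Nat.one_le_iff_ne_zero.2 (by positivity)
  have h4 : ‖(2 ^ n * n.factorial : ℂ)‖ = ((2 ^ n * n.factorial : ℕ) : ℝ) := by
    rw [← Complex.norm_natCast]; push_cast; rfl
  rw [h4]; exact this

/-- Moving in a suitable unimodular direction, a multilinear form adds up absolute values. -/
theorem MultilinearMap.exists_norm_add_le {ι V : Type*} [Fintype ι] [Nonempty ι]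
    [AddCommGroup V] [Module ℂ V] (B : MultilinearMap ℂ (fun _ : ι => V) ℂ) (z x : ι → V) :
    ∃ ω : ℂ, ‖ω‖ = 1 ∧ ‖B z‖ + ‖B x‖ ≤ ‖B (z + ω • x)‖ := by
  classical
  set d := Fintype.card ι with hd
  have hd0 : d ≠ 0 := Fintype.card_ne_zero
  have expand : ∀ ω : ℂ, B (z + ω • x) = ∑ s : Finset ι, ω ^ s.card * B (s.piecewise x z) := by
    intro ω
    rw [add_comm, B.map_add_univ]
    refine Finset.sum_congr rfl fun s _ => ?_
    have : s.piecewise (ω • x) z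
        = s.piecewise (fun i => (fun _ => ω) i • s.piecewise x z i) (s.piecewise x z) := by
      ext i; by_cases h : i ∈ s <;> simp [h]
    rw [this, B.map_piecewise_smul]; simp
  -- `η` is a `d`-th root of the phase that aligns `B x` with `B z`.
  obtain ⟨η, hη, hsum⟩ : ∃ η : ℂ, ‖η‖ = 1 ∧ ‖B z + η ^ d * B x‖ = ‖B z‖ + ‖B x‖ := by
    obtain ⟨c, hc, hcs⟩ : ∃ c : ℂ, ‖c‖ = 1 ∧ ‖B z + c * B x‖ = ‖B z‖ + ‖B x‖ := by
      by_cases hx : B x = 0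
      · exact ⟨1, by simp, by simp [hx]⟩
      by_cases hz : B z = 0
      · exact ⟨1, by simp, by simp [hz]⟩
      have hx' : (‖B x‖ : ℂ) ≠ 0 := by simpa using hx
      have hz' : (‖B z‖ : ℂ) ≠ 0 := by simpa using hz
      refine ⟨(B z / ‖B z‖) * (‖B x‖ / B x), ?_, ?_⟩
      · simp [hx, hz]
      · have : B z + (B z / ‖B z‖) * (‖B x‖ / B x) * B x
            = (B z / ‖B z‖) * ((‖B z‖ + ‖B x‖ : ℝ) : ℂ) := by
          push_cast; field_simp
        rw [this, norm_mul, norm_div, Complex.norm_real, Complex.norm_real, norm_norm,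
          div_self (by simpa using hz), one_mul, Real.norm_of_nonneg (by positivity)]
    obtain ⟨η, rfl⟩ := IsAlgClosed.exists_pow_nat_eq c (Nat.pos_of_ne_zero hd0)
    refine ⟨η, ?_, hcs⟩
    rw [norm_pow] at hc
    exact (pow_eq_one_iff_of_nonneg (norm_nonneg _) hd0).1 hc
  obtain ⟨ζ, hζ⟩ : ∃ ζ : ℂ, IsPrimitiveRoot ζ d := ⟨_, Complex.isPrimitiveRoot_exp d hd0⟩
  have hζ1 : ‖ζ‖ = 1 := hζ.norm'_eq_one hd0
  -- Averaging over `d`-th roots of unity kills the mixed terms, those of degree strictly between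
  -- `0` and `d` in `ω`; some rotation then does at least as well as the average.
  have avg : ∑ k ∈ Finset.range d, B (z + (η * ζ ^ k) • x) = d * (B z + η ^ d * B x) := by
    simp_rw [expand]
    rw [Finset.sum_comm]
    have inner : ∀ s : Finset ι, ∑ k ∈ Finset.range d, (η * ζ ^ k) ^ s.card * B (s.piecewise x z)
        = (if s = ∅ then d * B z else 0) + if s = Finset.univ then d * (η ^ d * B x) else 0 := by
      intro s
      have hfac : ∀ k, (η * ζ ^ k) ^ s.card * B (s.piecewise x z)
          = (η ^ s.card * B (s.piecewise x z)) * (ζ ^ s.card) ^ k := by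
        intro k; rw [mul_pow, ← pow_mul, ← pow_mul, mul_comm k]; ring
      simp_rw [hfac, ← Finset.mul_sum]
      by_cases h0 : s = ∅
      · subst h0
        simp [(Finset.univ_nonempty (α := ι)).ne_empty.symm, mul_comm]
      by_cases hu : s = Finset.univ
      · subst hu
        rw [Finset.card_univ, ← hd, hζ.pow_eq_one]
        simp [(Finset.univ_nonempty (α := ι)).ne_empty]
        ring
      have hlt : s.card < d := by
        rw [hd, ← Finset.card_univ]; exact Finset.card_lt_card (Finset.ssubset_univ_iff.2 hu)
      have hne : ζ ^ s.card ≠ 1 := hζ.pow_ne_one_of_pos_of_lt (by simpa using h0) hlt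
      have : ∑ k ∈ Finset.range d, (ζ ^ s.card) ^ k = 0 := by
        rw [geom_sum_eq hne, ← pow_mul, mul_comm, pow_mul, hζ.pow_eq_one]; simp
      simp [this, h0, hu]
    simp_rw [inner, Finset.sum_add_distrib]
    simp; ring
  by_contra! H
  have hlt : ‖∑ k ∈ Finset.range d, B (z + (η * ζ ^ k) • x)‖
      < ∑ k ∈ Finset.range d, (‖B z‖ + ‖B x‖) :=
    (norm_sum_le _ _).trans_lt (Finset.sum_lt_sum_of_nonempty (by simpa using hd0)
      fun k _ => H _ (by simp [hη, hζ1]))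
  rw [avg, norm_mul, hsum] at hlt
  simp [mul_add] at hlt

/-- Vectors are added one at a time, each with its own phase; the earlier phases stay fixed. -/
theorem MultilinearMap.exists_sum_norm_le {ι V T : Type*} [Fintype ι] [Nonempty ι]
    [AddCommGroup V] [Module ℂ V] (B : MultilinearMap ℂ (fun _ : ι => V) ℂ) (x : T → ι → V)
    (J : Finset T) :
    ∃ θ : T → ℂ, (∀ t, ‖θ t‖ = 1) ∧ ∑ t ∈ J, ‖B (x t)‖ ≤ ‖B (∑ t ∈ J, θ t • x t)‖ := by
  classical
  induction J using Finset.induction_on with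
  | empty => exact ⟨fun _ => 1, by simp, by simp⟩
  | insert t J ht ih =>
    obtain ⟨θ, hθ, hle⟩ := ih
    obtain ⟨ω, hω, hadd⟩ := B.exists_norm_add_le (∑ t ∈ J, θ t • x t) (x t)
    refine ⟨Function.update θ t ω, fun s => ?_, ?_⟩
    · by_cases h : s = t
      · subst h; simpa
      · simp [h, hθ]
    · rw [Finset.sum_insert ht, Finset.sum_insert ht]
      have : ∑ s ∈ J, Function.update θ t ω s • x s = ∑ s ∈ J, θ s • x s :=
        Finset.sum_congr rfl fun s hs => by
          rw [Function.update_of_ne (ne_of_mem_of_not_mem hs ht)]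
      rw [this, Function.update_self, add_comm (ω • x t)]
      linarith

/-! ### Almost disjoint families. -/

theorem not_countable_set_nat : ¬ Countable (Set ℕ) := fun _ =>
  let ⟨f, hf⟩ := exists_injective_nat (Set ℕ)
  Function.cantor_injective f hf

/-- Every infinite set of natural numbers contains an uncountable almost disjoint family of
infinite sets. -/
theorem Set.Infinite.exists_almost_disjoint {M : Set ℕ} (hM : M.Infinite) :
    ∃ N : Set ℕ → Set ℕ, (∀ s, N s ⊆ M) ∧ (∀ s, (N s).Infinite) ∧
      ∀ s t, s ≠ t → (N s ∩ N t).Finite := by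
  classical
  let g : ℕ × Finset ℕ → ℕ := fun p => (hM.natEmbedding M (Encodable.encode p) : ℕ)
  have hg : Function.Injective g := Subtype.val_injective.comp
    ((hM.natEmbedding M).injective.comp Encodable.encode_injective)
  -- Sets are branches of the binary tree and `code s n` is the node of `s` at level `n`; distinct
  -- branches share only finitely many nodes.
  let code : Set ℕ → ℕ → ℕ × Finset ℕ := fun s n => (n, (Finset.range n).filter (· ∈ s))
  refine ⟨fun s => Set.range fun n => g (code s n), ?_, ?_, ?_⟩
  · rintro s _ ⟨n, rfl⟩
    exact Subtype.coe_prop _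
  · exact fun s => Set.infinite_range_of_injective
      (hg.comp fun m n h => congrArg Prod.fst h)
  · intro s t hst
    obtain ⟨k, hk⟩ : ∃ k, ¬ (k ∈ s ↔ k ∈ t) := by
      by_contra! H; exact hst (Set.ext H)
    refine ((Set.finite_Iic k).image fun n => g (code s n)).subset ?_
    rintro _ ⟨⟨m, rfl⟩, ⟨n, hn⟩⟩
    refine ⟨m, ?_, rfl⟩
    have h := hg hn
    obtain rfl : n = m := congrArg Prod.fst h
    have h2 : (Finset.range n).filter (· ∈ t) = (Finset.range n).filter (· ∈ s) :=
      congrArg Prod.snd h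
    rw [Set.mem_Iic]
    by_contra! hlt
    have := Finset.ext_iff.1 h2 k
    simp only [Finset.mem_filter, Finset.mem_range, hlt, true_and] at this
    exact hk this.symm

/-! ### Operators and vectors in `LInfty`. -/

namespace LInfty

theorem norm_apply_le (v : LInfty) (m : ℕ) : ‖v m‖ ≤ ‖v‖ :=
  lp.norm_apply_le_norm ENNReal.top_ne_zero v m

theorem norm_le {v : LInfty} {C : ℝ} (hC : 0 ≤ C) (h : ∀ m, ‖v m‖ ≤ C) : ‖v‖ ≤ C :=
  lp.norm_le_of_forall_le hC h

/-- The operator `v ↦ (w m * v (q m))_m`. -/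
noncomputable def weightedComp (q : ℕ → ℕ) (w : ℕ → ℂ) (hw : ∀ m, ‖w m‖ ≤ 1) :
    LInfty →ₗ[ℂ] LInfty where
  toFun v := ⟨fun m => w m * v (q m), memℓp_infty ⟨‖v‖, by
    rintro _ ⟨m, rfl⟩
    simpa using mul_le_mul (hw m) (norm_apply_le v (q m)) (norm_nonneg _) zero_le_one⟩⟩
  map_add' u v := by ext m; exact mul_add _ _ _
  map_smul' c v := by ext m; simp [mul_left_comm]

theorem weightedComp_apply (q : ℕ → ℕ) (w : ℕ → ℂ) (hw : ∀ m, ‖w m‖ ≤ 1) (v : LInfty) (m : ℕ) :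
    weightedComp q w hw v m = w m * v (q m) := rfl

theorem norm_weightedComp_le (q : ℕ → ℕ) (w : ℕ → ℂ) (hw : ∀ m, ‖w m‖ ≤ 1) (v : LInfty) :
    ‖weightedComp q w hw v‖ ≤ ‖v‖ := by
  refine norm_le (norm_nonneg _) fun m => ?_
  rw [weightedComp_apply, norm_mul]
  simpa using mul_le_mul (hw m) (norm_apply_le v (q m)) (norm_nonneg _) zero_le_one

/-- A weighted composition operator is isometric if every index is hit with a unimodular
weight. -/
noncomputable def weightedCompIsometry (q : ℕ → ℕ) (w : ℕ → ℂ) (hw : ∀ m, ‖w m‖ ≤ 1)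
    (h : ∀ k, ∃ m, q m = k ∧ ‖w m‖ = 1) : LInfty →ₗᵢ[ℂ] LInfty where
  toLinearMap := weightedComp q w hw
  norm_map' v := by
    refine le_antisymm (norm_weightedComp_le q w hw v) (norm_le (norm_nonneg _) fun k => ?_)
    obtain ⟨m, rfl, hm⟩ := h k
    have := norm_apply_le (weightedComp q w hw v) m
    rwa [weightedComp_apply, norm_mul, hm, one_mul] at this

theorem weightedCompIsometry_apply (q : ℕ → ℕ) (w : ℕ → ℂ) (hw : ∀ m, ‖w m‖ ≤ 1)
    (h : ∀ k, ∃ m, q m = k ∧ ‖w m‖ = 1) (v : LInfty) (m : ℕ) :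
    weightedCompIsometry q w hw h v m = w m * v (q m) := rfl

/-- The coordinate vectors of `LInfty`. -/
noncomputable def basisVec (k : ℕ) : LInfty := lp.single ∞ k (1 : ℂ)

theorem basisVec_apply (k m : ℕ) : basisVec k m = if m = k then 1 else 0 := by
  simp [basisVec, Pi.single_apply]

theorem finsum_apply {T : Type*} (J : Finset T) (f : T → LInfty) (m : ℕ) :
    (∑ t ∈ J, f t : LInfty) m = ∑ t ∈ J, f t m := by
  rw [lp.coeFn_sum, Finset.sum_apply]

theorem eq_sum_basisVec (v : LInfty) (F : Finset ℕ) (hF : ∀ m ∉ F, v m = 0) :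
    v = ∑ k ∈ F, v k • basisVec k := by
  ext m
  rw [finsum_apply]
  simp only [lp.coeFn_smul, Pi.smul_apply, basisVec_apply, smul_eq_mul, mul_ite, mul_one, mul_zero,
    Finset.sum_ite_eq]
  split_ifs with h
  · rfl
  · exact hF m h

/-- An isometry onto the sequences supported in the range of an injection. -/
theorem exists_isometry_support_subset {M : Set ℕ} (hM : M.Infinite) :
    ∃ T : LInfty →ₗᵢ[ℂ] LInfty, ∀ v, Function.support (T v) ⊆ M := by
  classical
  let g := hM.natEmbedding M
  have hg : Function.Injective fun k => (g k : ℕ) := Subtype.val_injective.comp g.injective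
  -- Off the range, `invFun` takes a junk value, which the zero weight erases.
  let w : ℕ → ℂ := fun m => if m ∈ Set.range (fun k => (g k : ℕ)) then 1 else 0
  refine ⟨weightedCompIsometry (Function.invFun fun k => (g k : ℕ)) w (fun m => ?_) (fun k => ?_),
    fun v m hm => ?_⟩
  · simp only [w]; split_ifs <;> simp
  · exact ⟨g k, Function.leftInverse_invFun hg k, by simp [w]⟩
  · rw [Function.mem_support, weightedCompIsometry_apply] at hm
    by_contra hmM
    refine hm ?_
    have : m ∉ Set.range (fun k => (g k : ℕ)) := by
      rintro ⟨k, rfl⟩; exact hmM (g k).2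
    simp only [w, this, if_false, zero_mul]

/-- Disjointly supported vectors of norm one, attained, are the images of the coordinate vectors
under an isometry. -/
theorem exists_isometry_basisVec (u : ℕ → LInfty) (hn : ∀ k m, ‖u k m‖ ≤ 1)
    (ha : ∀ k, ∃ m, ‖u k m‖ = 1)
    (hd : ∀ k l, k ≠ l → Disjoint (Function.support (u k)) (Function.support (u l))) :
    ∃ T : LInfty →ₗᵢ[ℂ] LInfty, ∀ k, T (basisVec k) = u k := by
  classical
  -- `q m` is the block containing `m`. The default `0` is harmless: the weight `u 0 m` vanishes
  -- there.
  let q : ℕ → ℕ := fun m => if h : ∃ k, u k m ≠ 0 then h.choose else 0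
  have hq : ∀ k m, u k m ≠ 0 → q m = k := by
    intro k m h
    have hex : ∃ k, u k m ≠ 0 := ⟨k, h⟩
    simp only [q, dif_pos hex]
    by_contra hne
    exact Set.disjoint_left.1 (hd _ _ hne) hex.choose_spec h
  refine ⟨weightedCompIsometry q (fun m => u (q m) m) (fun m => hn _ m) (fun k => ?_), fun k => ?_⟩
  · obtain ⟨m, hm⟩ := ha k
    have h := hq k m (by rw [← norm_ne_zero_iff, hm]; exact one_ne_zero)
    exact ⟨m, h, by rw [h, hm]⟩
  · ext m
    rw [weightedCompIsometry_apply, basisVec_apply]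
    split_ifs with h
    · rw [h, mul_one]
    · rw [mul_zero]
      by_contra hne
      exact h (hq k m (Ne.symm hne))

/-- Indicators of distinct sets are at distance at least one, so the balls of radius `1 / 2` around
them are disjoint and uncountably many. -/
theorem not_separableSpace : ¬ TopologicalSpace.SeparableSpace LInfty := by
  classical
  intro _
  let χ : Set ℕ → LInfty := fun s => ⟨fun m => if m ∈ s then 1 else 0, memℓp_infty ⟨1, by
    rintro _ ⟨m, rfl⟩
    dsimp only
    split_ifs <;> simp⟩⟩
  have hχ : ∀ s m, χ s m = if m ∈ s then 1 else 0 := fun _ _ => rfl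
  have hdisj : Set.PairwiseDisjoint (Set.univ : Set (Set ℕ))
      fun s => Metric.ball (χ s) (1 / 2) := by
    intro s _ t _ hst
    refine Metric.ball_disjoint_ball ?_
    obtain ⟨m, hm⟩ : ∃ m, ¬ (m ∈ s ↔ m ∈ t) := by
      by_contra! H; exact hst (Set.ext H)
    have h := norm_apply_le (χ s - χ t) m
    rw [lp.coeFn_sub, Pi.sub_apply, hχ, hχ] at h
    rw [dist_eq_norm]
    by_cases h1 : m ∈ s <;> by_cases h2 : m ∈ t <;> simp [h1, h2] at h hm <;> linarith
  have := hdisj.countable_of_isOpen (fun _ _ => Metric.isOpen_ball)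
    (fun s _ => Metric.nonempty_ball.2 (by norm_num))
  rw [Set.countable_univ_iff] at this
  exact not_countable_set_nat this

/-- A sequence splits into a part that vanishes on a given finite set and a finitely supported
remainder. -/
theorem exists_add_eq_of_finite (F : Set ℕ) (hF : F.Finite) (v : LInfty) :
    ∃ y c : LInfty, v = y + c ∧ (∀ m ∈ F, y m = 0) ∧ (∀ m ∉ F, y m = v m) ∧
      Function.support y ⊆ Function.support v ∧ Function.support c ⊆ Function.support v ∧
      (Function.support c).Finite := by
  classical
  let w : ℕ → ℂ := fun m => if m ∈ F then 0 else 1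
  have hw : ∀ m, ‖w m‖ ≤ 1 := fun m => by simp only [w]; split_ifs <;> simp
  have hy : ∀ m, weightedComp id w hw v m = if m ∈ F then 0 else v m := by
    intro m; simp [weightedComp_apply, w]
  have hc : ∀ m, (v - weightedComp id w hw v) m = if m ∈ F then v m else 0 := by
    intro m; rw [lp.coeFn_sub, Pi.sub_apply, hy]; split_ifs <;> simp
  refine ⟨weightedComp id w hw v, v - weightedComp id w hw v, by simp, ?_, ?_, ?_, ?_, ?_⟩
  · intro m hm; simp [hy, hm]
  · intro m hm; simp [hy, hm]
  · intro m hm; rw [Function.mem_support, hy] at hm; split_ifs at hm <;> simp_all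
  · intro m hm; rw [Function.mem_support, hc] at hm; split_ifs at hm <;> simp_all
  · refine hF.subset fun m hm => ?_
    rw [Function.mem_support, hc] at hm
    by_contra h
    simp [h] at hm

/-- A multilinear form on `LInfty` that vanishes as soon as prescribed slots hold coordinate
vectors vanishes as soon as these slots hold finitely supported vectors. -/
theorem map_eq_zero_of_finite_support {ι : Type*} [Fintype ι]
    (A : MultilinearMap ℂ (fun _ : ι => LInfty) ℂ) (S : Set ι) (v : ι → LInfty)
    (hv : ∀ i ∉ S, (Function.support (v i)).Finite)
    (h : ∀ w : ι → LInfty, (∀ i ∈ S, w i = v i) → (∀ i ∉ S, ∃ k, w i = basisVec k) → A w = 0) :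
    A v = 0 := by
  classical
  -- Slots in `S` get a one-term sum over the dummy index `0`, so that a single expansion treats all
  -- slots.
  let F : ι → Finset ℕ := fun i => if hi : i ∈ S then {0} else (hv i hi).toFinset
  let g : ι → ℕ → LInfty := fun i k => if i ∈ S then v i else basisVec k
  let c : ι → ℕ → ℂ := fun i k => if i ∈ S then 1 else v i k
  have hv' : v = fun i => ∑ k ∈ F i, c i k • g i k := by
    ext1 i
    by_cases hi : i ∈ S
    · simp [F, g, c, hi]
    · simp only [F, g, c, hi, if_false, dif_neg, not_false_eq_true]
      exact eq_sum_basisVec _ _ fun m hm => by simpa using hm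
  rw [hv', A.map_sum_finset]
  refine Finset.sum_eq_zero fun r _ => ?_
  rw [A.map_smul_univ, h (fun i => g i (r i)), smul_zero]
  · intro i hi; simp [g, hi]
  · intro i hi; exact ⟨r i, by simp [g, hi]⟩

end LInfty

/-! ### Vanishing on an infinite set of coordinates. -/

namespace LInfty

section AlmostDisjoint

variable {ι T : Type*} [Fintype ι] [Nonempty ι] (B : MultilinearMap ℂ (fun _ : ι => LInfty) ℂ)
  {K : ℝ} {M : Set ℕ} {N : T → Set ℕ}

/-- On an almost disjoint family, a bounded form that ignores finitely supported perturbations has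
absolutely bounded sums. -/
theorem sum_norm_le_of_almost_disjoint (hK : ∀ v : ι → LInfty, (∀ i, ‖v i‖ ≤ 1) → ‖B v‖ ≤ K)
    (hB : ∀ v : ι → LInfty, (∀ i, Function.support (v i) ⊆ M) →
      (∃ i, (Function.support (v i)).Finite) → B v = 0)
    (hNM : ∀ t, N t ⊆ M) (hN : ∀ s t, s ≠ t → (N s ∩ N t).Finite)
    (x : T → ι → LInfty) (hx : ∀ t i, ‖x t i‖ ≤ 1)
    (hxN : ∀ t i, Function.support (x t i) ⊆ N t) (J : Finset T) :
    ∑ t ∈ J, ‖B (x t)‖ ≤ K := by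
  classical
  obtain ⟨θ, hθ, hle⟩ := B.exists_sum_norm_le x J
  refine hle.trans ?_
  set v : ι → LInfty := ∑ t ∈ J, θ t • x t with hv
  have hvi : ∀ i m, v i m = ∑ t ∈ J, θ t * x t i m := by
    intro i m
    rw [hv, Finset.sum_apply, finsum_apply]
    rfl
  have hx0 : ∀ t i m, m ∉ N t → x t i m = 0 := fun t i m hm => by
    by_contra h; exact hm (hxN t i h)
  have hvM : ∀ i, Function.support (v i) ⊆ M := by
    intro i m hm
    by_contra hmM
    refine hm ?_
    rw [hvi]
    exact Finset.sum_eq_zero fun t _ => by rw [hx0 t i m fun h => hmM (hNM t h), mul_zero]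
  -- Outside the finite set `F` of all overlaps, at most one summand of `v` is nonzero at each
  -- coordinate.
  let F : Set ℕ := ⋃ s ∈ J, ⋃ t ∈ J, if s = t then ∅ else N s ∩ N t
  have hF : F.Finite := by
    refine J.finite_toSet.biUnion fun s _ => J.finite_toSet.biUnion fun t _ => ?_
    split_ifs with h
    · exact Set.finite_empty
    · exact hN s t h
  choose y c hvyc hyF hyFc hysupp hcsupp hcfin using fun i => exists_add_eq_of_finite F hF (v i)
  -- Every other term in the expansion of `B (y + c)` has a finitely supported entry.
  have hvy : B v = B y := by
    have : v = y + c := funext hvyc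
    rw [this, B.map_add_univ, Finset.sum_eq_single Finset.univ]
    · simp
    · intro s _ hs
      obtain ⟨i, hi⟩ : ∃ i, i ∉ s := by
        by_contra! H; exact hs (Finset.eq_univ_iff_forall.2 H)
      refine hB _ (fun j => ?_) ⟨i, by simpa [hi] using hcfin i⟩
      by_cases hj : j ∈ s
      · simpa [hj] using (hysupp j).trans (hvM j)
      · simpa [hj] using (hcsupp j).trans (hvM j)
    · simp
  rw [hvy]
  refine hK y fun i => norm_le zero_le_one fun m => ?_
  by_cases hm : m ∈ F
  · simp [hyF i m hm]
  rw [hyFc i m hm, hvi]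
  by_cases hex : ∃ t ∈ J, m ∈ N t
  · obtain ⟨t, ht, hmt⟩ := hex
    rw [Finset.sum_eq_single_of_mem t ht]
    · rw [norm_mul, hθ, one_mul]
      exact (norm_apply_le _ m).trans (hx t i)
    · intro s hs hst
      rw [hx0 s i m, mul_zero]
      intro hms
      refine hm (Set.mem_biUnion hs (Set.mem_biUnion ht ?_))
      rw [if_neg hst]
      exact ⟨hms, hmt⟩
  · push Not at hex
    rw [Finset.sum_eq_zero fun t ht => by rw [hx0 t i m (hex t ht), mul_zero]]
    simp

/-- After rescaling witnesses into the unit ball, bounded finite sums make their values summable,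
and a summable family has countable support. -/
theorem countable_setOf_ne_zero_of_almost_disjoint
    (hK : ∀ v : ι → LInfty, (∀ i, ‖v i‖ ≤ 1) → ‖B v‖ ≤ K)
    (hB : ∀ v : ι → LInfty, (∀ i, Function.support (v i) ⊆ M) →
      (∃ i, (Function.support (v i)).Finite) → B v = 0)
    (hNM : ∀ t, N t ⊆ M) (hN : ∀ s t, s ≠ t → (N s ∩ N t).Finite) :
    {t | ∃ v : ι → LInfty, (∀ i, Function.support (v i) ⊆ N t) ∧ B v ≠ 0}.Countable := by
  set bad := {t | ∃ v : ι → LInfty, (∀ i, Function.support (v i) ⊆ N t) ∧ B v ≠ 0}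
  have : ∀ t : bad, ∃ v : ι → LInfty, (∀ i, ‖v i‖ ≤ 1) ∧
      (∀ i, Function.support (v i) ⊆ N t) ∧ B v ≠ 0 := by
    rintro ⟨t, v, hv, hBv⟩
    have hc : ∀ i, (0 : ℝ) < ‖v i‖ + 1 := fun i => by positivity
    have hc' : ∀ i, (((‖v i‖ + 1)⁻¹ : ℝ) : ℂ) ≠ 0 := fun i => by
      exact_mod_cast (inv_pos.2 (hc i)).ne'
    refine ⟨fun i => (((‖v i‖ + 1)⁻¹ : ℝ) : ℂ) • v i, fun i => ?_, fun i m hm => hv i ?_, ?_⟩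
    · rw [norm_smul, Complex.norm_real, Real.norm_of_nonneg (inv_pos.2 (hc i)).le,
        inv_mul_le_one₀ (hc i)]
      linarith
    · intro h0
      refine hm ?_
      rw [lp.coeFn_smul, Pi.smul_apply, h0, smul_zero]
    · rw [B.map_smul_univ]
      exact smul_ne_zero (Finset.prod_ne_zero_iff.2 fun i _ => hc' i) hBv
  choose x hx hxN hBx using this
  have hsum : Summable fun t : bad => ‖B (x t)‖ :=
    summable_of_sum_le (fun _ => norm_nonneg _) fun J =>
      sum_norm_le_of_almost_disjoint (N := fun t : bad => N t) B hK hB (fun t => hNM t)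
        (fun s t hst => hN s t fun h => hst (Subtype.ext h)) x hx hxN J
  have hcount := hsum.countable_support
  have huniv : Function.support (fun t : bad => ‖B (x t)‖) = Set.univ :=
    Set.eq_univ_of_forall fun t => norm_ne_zero_iff.2 (hBx t)
  rw [huniv, Set.countable_univ_iff] at hcount
  exact Set.countable_coe_iff.1 hcount

end AlmostDisjoint

/-- A bounded multilinear form that vanishes on the coordinate vectors vanishes on all sequences
supported in some infinite set. -/
theorem exists_infinite_forall_map_eq_zero {n : ℕ}
    (A : MultilinearMap ℂ (fun _ : Fin n => LInfty) ℂ) {K : ℝ}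
    (hK : ∀ v : Fin n → LInfty, (∀ i, ‖v i‖ ≤ 1) → ‖A v‖ ≤ K)
    (hA : ∀ r : Fin n → ℕ, A (fun i => basisVec (r i)) = 0) :
    ∃ M : Set ℕ, M.Infinite ∧
      ∀ v : Fin n → LInfty, (∀ i, Function.support (v i) ⊆ M) → A v = 0 := by
  classical
  -- `d` bounds the number of slots not required to hold coordinate vectors; `d = n` is the claim.
  have key : ∀ d : ℕ, ∃ M : Set ℕ, M.Infinite ∧ ∀ S : Finset (Fin n), S.card ≤ d →
      ∀ v : Fin n → LInfty, (∀ i ∈ S, Function.support (v i) ⊆ M) →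
        (∀ i ∉ S, ∃ k, v i = basisVec k) → A v = 0 := by
    intro d
    induction d with
    | zero =>
      refine ⟨Set.univ, Set.infinite_univ, fun S hS v _ hv => ?_⟩
      obtain rfl : S = ∅ := Finset.card_eq_zero.1 (Nat.le_zero.1 hS)
      choose r hr using fun i => hv i (Finset.notMem_empty i)
      rw [funext hr]
      exact hA r
    | succ d ih =>
      obtain ⟨M, hM, hgood⟩ := ih
      obtain ⟨N, hNM, hNinf, hN⟩ := hM.exists_almost_disjoint
      let B : ∀ S : Finset (Fin n), (Fin n → ℕ) →
          MultilinearMap ℂ (fun _ : {i // i ∈ S} => LInfty) ℂ := fun S e =>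
        A.domDomRestrict (· ∈ S) fun i => basisVec (e i)
      have hBapp : ∀ S e v, B S e v = A fun i => if h : i ∈ S then v ⟨i, h⟩ else basisVec (e i) :=
        fun _ _ _ => rfl
      let bad : Finset (Fin n) → (Fin n → ℕ) → Set (Set ℕ) := fun S e =>
        {t | ∃ v : {i // i ∈ S} → LInfty, (∀ i, Function.support (v i) ⊆ N t) ∧ B S e v ≠ 0}
      have hbad : ∀ S, S.card = d + 1 → ∀ e, (bad S e).Countable := by
        intro S hS e
        have : Nonempty {i // i ∈ S} := by
          obtain ⟨i, hi⟩ := Finset.card_pos.1 (hS ▸ Nat.succ_pos d : 0 < S.card)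
          exact ⟨⟨i, hi⟩⟩
        refine countable_setOf_ne_zero_of_almost_disjoint (K := K) (M := M) (B S e)
          (fun v hv => ?_) (fun v hv hfin => ?_) hNM hN
        · rw [hBapp]
          refine hK _ fun i => ?_
          split_ifs with h
          · exact hv _
          · refine norm_le zero_le_one fun m => ?_
            rw [basisVec_apply]
            split_ifs <;> simp
        · obtain ⟨⟨i₀, hi₀⟩, hfin⟩ := hfin
          rw [hBapp]
          -- Expanding the finitely supported slot `i₀` in coordinate vectors leaves `d` free slots,
          -- where `hgood` applies.
          refine map_eq_zero_of_finite_support A {i | i ≠ i₀} _ (fun i hi => ?_) fun w hw hw' => ?_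
          · obtain rfl : i = i₀ := not_not.1 hi
            simpa [hi₀] using hfin
          · refine hgood (S.erase i₀) ?_ w (fun i hi => ?_) fun i hi => ?_
            · rw [Finset.card_erase_of_mem hi₀, hS, Nat.add_sub_cancel]
            · rw [hw i (Finset.ne_of_mem_erase hi), dif_pos (Finset.mem_of_mem_erase hi)]
              exact hv _
            · by_cases h : i = i₀
              · exact hw' i (not_not.2 h)
              · have hiS : i ∉ S := fun hS => hi (Finset.mem_erase.2 ⟨h, hS⟩)
                exact ⟨e i, by rw [hw i h, dif_neg hiS]⟩
      -- There are only countably many pairs `(S, e)`, each with countably many bad `t`.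
      obtain ⟨t, ht⟩ : ∃ t, ∀ S, S.card = d + 1 → ∀ e, t ∉ bad S e := by
        by_contra! H
        refine not_countable_set_nat (Set.countable_univ_iff.1 ?_)
        refine (Set.countable_iUnion fun S : {S : Finset (Fin n) // S.card = d + 1} =>
          Set.countable_iUnion fun e => hbad S.1 S.2 e).mono fun t _ => ?_
        obtain ⟨S, hS, e, h⟩ := H t
        exact Set.mem_iUnion.2 ⟨⟨S, hS⟩, Set.mem_iUnion.2 ⟨e, h⟩⟩
      refine ⟨N t, hNinf t, fun S hS v hvS hvS' => ?_⟩
      rcases Nat.le_succ_iff.1 hS with hS | hS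
      · exact hgood S hS v (fun i hi => (hvS i hi).trans (hNM t)) hvS'
      · have he : ∀ i, ∃ k, i ∉ S → v i = basisVec k := fun i => by
          by_cases hi : i ∈ S
          · exact ⟨0, fun h => absurd hi h⟩
          · obtain ⟨k, hk⟩ := hvS' i hi
            exact ⟨k, fun _ => hk⟩
        choose e he using he
        by_contra hne
        refine ht S hS e ⟨fun i => v i, fun i => hvS i i.2, ?_⟩
        rw [hBapp]
        convert! hne using 2
        ext1 i
        split_ifs with h
        · rfl
        · exact (he i h).symm
  obtain ⟨M, hM, h⟩ := key n
  exact ⟨M, hM, fun v hv => h Finset.univ (by simp) v (fun i _ => hv i) fun i hi => by simp at hi⟩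

end LInfty

/-! ### Construction of the blocks. -/

namespace LInfty

/-- A normalized finitely supported vector, disjoint from finitely many given ones, such that a
multilinear form vanishes on all tuples of these vectors in which the new one occurs. -/
theorem exists_finite_support_forall_map_eq_zero {n : ℕ}
    (A : MultilinearMap ℂ (fun _ : Fin n => LInfty) ℂ) (U : Finset LInfty)
    (hU : ∀ x ∈ U, (Function.support x).Finite) :
    ∃ u : LInfty, (Function.support u).Finite ∧ (∀ m, ‖u m‖ ≤ 1) ∧ (∃ m, ‖u m‖ = 1) ∧
      (∀ x ∈ U, Disjoint (Function.support x) (Function.support u)) ∧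
      ∀ v : Fin n → LInfty, (∀ j, v j = u ∨ v j ∈ U) → (∃ j, v j = u) → A v = 0 := by
  classical
  obtain ⟨L, hL⟩ : ∃ L : ℕ, ∀ x ∈ U, ∀ m, L ≤ m → x m = 0 := by
    have hfin : (⋃ x ∈ U, Function.support x).Finite := U.finite_toSet.biUnion hU
    obtain ⟨L, hL⟩ := hfin.bddAbove
    refine ⟨L + 1, fun x hx m hm => ?_⟩
    by_contra hne
    have : m ≤ L := hL (Set.mem_biUnion hx hne)
    omega
  -- A pattern marks the new vector by `none`; each pattern containing it is one equation, and `N`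
  -- is one more than their number.
  let R := {r : Fin n → Option U // ∃ j, r j = none}
  let N := Nat.card R + 1
  let e : Fin N → LInfty := fun i => basisVec (L + i)
  let y : (Fin N → ℂ) → LInfty := fun a => ∑ i, a i • e i
  have hy : ∀ a m, y a m = ∑ i : Fin N, if m = L + i then a i else 0 := by
    intro a m
    rw [finsum_apply]
    simp [e, basisVec_apply]
  have hy1 : ∀ a (i : Fin N), y a (L + i) = a i := by
    intro a i
    rw [hy, Finset.sum_eq_single i] <;> simp
    intro j hj h
    exact absurd (Fin.ext h.symm) hj
  have hy0 : ∀ a m, (∀ i : Fin N, m ≠ L + i) → y a m = 0 := by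
    intro a m h
    rw [hy]
    exact Finset.sum_eq_zero fun i _ => if_neg (h i)
  have hp : ∀ r : R, ∃ p : MvPolynomial (Fin N) ℂ, ∀ a,
      MvPolynomial.eval a p = A fun j => (r.1 j).elim (y a) (fun x => (x : LInfty)) := by
    intro r
    obtain ⟨p, hp⟩ := A.exists_mvPolynomial
      (fun j i => (r.1 j).elim (MvPolynomial.X i) fun _ => if i = 0 then 1 else 0)
      (fun j i => (r.1 j).elim (e i) fun x => (x : LInfty))
    refine ⟨p, fun a => ?_⟩
    rw [hp]
    congr 1
    ext1 j
    cases r.1 j <;> simp [y, apply_ite]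
  choose p hp using hp
  obtain ⟨a, ha, hpa⟩ := MvPolynomial.exists_ne_zero_forall_eval_eq_zero (Nat.lt_succ_self _) p
    fun r => by
      obtain ⟨j, hj⟩ := r.2
      rw [hp]
      refine A.map_coord_zero j ?_
      simp [hj, y]
  obtain ⟨i₀, -, hi₀⟩ := Finset.exists_max_image Finset.univ (fun i => ‖a i‖)
    (Finset.univ_nonempty (α := Fin N))
  have hpos : 0 < ‖a i₀‖ := by
    obtain ⟨i, hi⟩ := Function.ne_iff.1 ha
    exact (norm_pos_iff.2 hi).trans_le (hi₀ i (Finset.mem_univ i))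
  -- Dividing by a coefficient of largest modulus makes the norm one and attained.
  let b : Fin N → ℂ := fun i => (a i₀)⁻¹ * a i
  have hyb : y b = (a i₀)⁻¹ • y a := by
    simp only [y, b, Finset.smul_sum, smul_smul]
  have hsupp : ∀ m, y b m ≠ 0 → ∃ i : Fin N, m = L + i := by
    intro m hm
    by_contra! H
    exact hm (hy0 b m H)
  refine ⟨y b, ?_, fun m => ?_, ⟨L + i₀, ?_⟩, fun x hx => ?_, fun v hv hex => ?_⟩
  · refine (Set.finite_range fun i : Fin N => L + (i : ℕ)).subset fun m hm => ?_
    obtain ⟨i, hi⟩ := hsupp m hm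
    exact ⟨i, hi.symm⟩
  · by_cases hm : ∃ i : Fin N, m = L + i
    · obtain ⟨i, rfl⟩ := hm
      rw [hy1, norm_mul, norm_inv, inv_mul_le_one₀ hpos]
      exact hi₀ i (Finset.mem_univ i)
    · push Not at hm
      simp [hy0 b m hm]
  · rw [hy1, norm_mul, norm_inv, inv_mul_cancel₀ hpos.ne']
  · refine Set.disjoint_left.2 fun m hmx hmu => hmx ?_
    obtain ⟨i, rfl⟩ := hsupp m hmu
    exact hL x hx _ (Nat.le_add_right _ _)
  · let r : Fin n → Option U := fun j =>
      if h : v j ≠ y b then some ⟨v j, (hv j).resolve_left h⟩ else none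
    have hr : ∃ j, r j = none := by
      obtain ⟨j, hj⟩ := hex
      exact ⟨j, dif_neg (not_not.2 hj)⟩
    have h0 := (hp ⟨r, hr⟩ a).symm.trans (hpa ⟨r, hr⟩)
    have hvr : v = fun j => (if v j ≠ y b then (1 : ℂ) else (a i₀)⁻¹) •
        (r j).elim (y a) (fun x => (x : LInfty)) := by
      ext1 j
      by_cases h : v j = y b
      · simp [r, h, hyb]
      · simp [r, h]
    rw [hvr, A.map_smul_univ, h0, smul_zero]

/-- Every multilinear form on `LInfty` vanishes on a normalized sequence of disjoint finite
blocks. -/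
theorem exists_blocks_forall_map_eq_zero {n : ℕ} (hn : 1 ≤ n)
    (A : MultilinearMap ℂ (fun _ : Fin n => LInfty) ℂ) :
    ∃ u : ℕ → LInfty, (∀ k m, ‖u k m‖ ≤ 1) ∧ (∀ k, ∃ m, ‖u k m‖ = 1) ∧
      (∀ k l, k ≠ l → Disjoint (Function.support (u k)) (Function.support (u l))) ∧
      ∀ r : Fin n → ℕ, A (fun i => u (r i)) = 0 := by
  classical
  let Good : Finset LInfty × LInfty → Prop := fun p =>
    (∀ x ∈ p.1, (Function.support x).Finite) ∧ (Function.support p.2).Finite ∧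
    (∀ m, ‖p.2 m‖ ≤ 1) ∧ (∃ m, ‖p.2 m‖ = 1) ∧
    (∀ x ∈ p.1, Disjoint (Function.support x) (Function.support p.2)) ∧
    ∀ v : Fin n → LInfty, (∀ j, v j = p.2 ∨ v j ∈ p.1) → (∃ j, v j = p.2) → A v = 0
  obtain ⟨f, hf, hlt⟩ := exists_seq_of_forall_finset_exists Good
    (fun p q => p.2 ∈ q.1) fun s hs => by
      have hU : ∀ x ∈ s.image Prod.snd, (Function.support x).Finite := by
        intro x hx
        obtain ⟨p, hp, rfl⟩ := Finset.mem_image.1 hx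
        exact (hs p hp).2.1
      obtain ⟨u, hu⟩ := exists_finite_support_forall_map_eq_zero A _ hU
      exact ⟨(s.image Prod.snd, u), ⟨hU, hu⟩, fun p hp => Finset.mem_image_of_mem _ hp⟩
  refine ⟨fun k => (f k).2, fun k => (hf k).2.2.1, fun k => (hf k).2.2.2.1, fun k l hkl => ?_,
    fun r => ?_⟩
  · rcases hkl.lt_or_gt with h | h
    · exact (hf l).2.2.2.2.1 _ (hlt k l h)
    · exact ((hf k).2.2.2.2.1 _ (hlt l k h)).symm
  · have : Nonempty (Fin n) := ⟨⟨0, hn⟩⟩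
    -- The latest block in the tuple plays the new vector; the others equal it or precede it.
    obtain ⟨j, hj⟩ := Finite.exists_max r
    refine (hf (r j)).2.2.2.2.2 _ (fun i => ?_) ⟨j, rfl⟩
    rcases (hj i).eq_or_lt with h | h
    · exact Or.inl (by rw [h])
    · exact Or.inr (hlt _ _ h)

end LInfty

/-! ### The subspace. -/

theorem theorem27 (n : ℕ) (hn : 1 ≤ n) (P : LInfty → ℂ)
    (hP : IsContHomogeneousPolynomial n P) :
    ∃ H : Submodule ℂ LInfty,
      (∀ x ∈ H, P x = 0) ∧
      Nonempty (LInfty ≃L[ℂ] H) ∧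
      ¬ TopologicalSpace.SeparableSpace H := by
  obtain ⟨⟨A, hsymm, hPA⟩, k, hk⟩ := hP
  obtain ⟨K, hK⟩ := A.exists_bound_of_diagonal hsymm k fun x => by
    rw [← hPA, Fintype.card_fin]; exact hk x
  obtain ⟨u, hu1, hua, hud, huA⟩ := LInfty.exists_blocks_forall_map_eq_zero hn A
  obtain ⟨T, hT⟩ := LInfty.exists_isometry_basisVec u hu1 hua hud
  obtain ⟨M, hM, hMA⟩ := LInfty.exists_infinite_forall_map_eq_zero
    (A.compLinearMap fun _ => T.toLinearMap) (K := K)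
    (fun v hv => hK _ fun i => (T.norm_map (v i)).trans_le (hv i))
    (fun r => by simpa [hT] using huA r)
  obtain ⟨J, hJ⟩ := LInfty.exists_isometry_support_subset hM
  let e : LInfty ≃L[ℂ] LinearMap.range (T.comp J).toLinearMap :=
    (T.comp J).equivRange.toContinuousLinearEquiv
  refine ⟨LinearMap.range (T.comp J).toLinearMap, ?_, ⟨e⟩, fun _ => ?_⟩
  · rintro _ ⟨x, rfl⟩
    rw [hPA]
    exact hMA (fun _ => J x) fun _ => hJ x
  · exact LInfty.not_separableSpace
      (e.symm.surjective.denseRange.separableSpace e.symm.continuous)
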